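/- Let $A\in\mathbb Q^{n\times n}$, $a,b\in\mathbb Q^n$, $c\in\mathbb Q$, and consider the affine loop "while $g(x)\ge 0$ do $x:=f(x)$" on $\mathbb R^n$ with $f(x)=Ax+a$ and $g(x)=b^{\top}x+c$. Let $M=\begin{pmatrix}A&a\\0&1\end{pmatrix}$ and assume that the loop is non-degenerate: no quotient of two distinct complex eigenvalues of $M$ is a root of unity. Let $\lambda_1,\dots,\lambda_s$ be the distinct non-zero eigenvalues of $M$, let $k_{\max}$ be the largest algebraic multiplicity among them, and let $I=\{0,\dots,k_{\max}-1\}\times\{1,\dots,s\}$. Preorder $I$ by $(i_1,j_1)\preccurlyeq(i_2,j_2)$ iff $|\lambda_{j_1}|<|\lambda_{j_2}|$, or $|\lambda_{j_1}|=|\lambda_{j_2}|$ and $i_1\le i_2$; let $\approx$ be the induced equivalence relation, and order its classes accordingly. Let $h_{i,j}:\mathbb R^n\to\mathbb C$ be the (unique) affine functions with $$g(f^m(x))=\sum_{(i,j)\in I}\binom mi\lambda_j^m\,h_{i,j}(x)\qquad\text{for all }x\in\mathbb R^n,\ m\ge n;$$ explicitly, $h_{i,j}(x)=\lambda_j^{-i}\,(b^{\top}\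 c)\,(M-\lambda_j)^i\,\pi_j\binom x1$, where $\pi_j$ is the projection of $\mathbb C^{n+1}$ onto the generalised eigenspace of $M$ for $\lambda_j$ along the sum of the other generalised eigenspaces. Put $\gamma_j=\lambda_j/|\lambda_j|$ and $$T(\gamma)=\Bigl\{\mu\in\mathbb C^s:\ |\mu_j|=1\text{ for all }j,\text{ and }\prod_j\mu_j^{v_j}=1\text{ for all }v\in\mathbb Z^s\text{ with }\prod_j\gamma_j^{v_j}=1\Bigr\}.$$ For an $\approx$-class $E$, $x\in\mathbb R^n$ and $\mu\in T(\gamma)$ let $\Phi_E(x,\mu)=\sum_{(i,j)\in E}h_{i,j}(x)\mu_j$, which is a real number. The class $E$ is dominant for $x$ if $h_{i,j}(x)=0$ for all $(i,j)$ in classes strictly above $E$. Let $\mathit{PN}$ be the set of all $x\in\mathbb R^n$ such that $\inf_{\mu\in T(\gamma)}\Phi_E(x,\mu)\ge 0$ for every class $E$ that is dominant for $x$ (equivalently, for the least such class, since $\Phi_{E'}(x,\cdot)=0$ for the classes $E'$ above it). If $z\in\mathit{PN}$, then every point $x$ in the relative interior of $\operatorname{conv}\{f^m(z):m\in\mathbb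 N\}$ is eventually non-terminating, that is, there is $N\in\mathbb N$ with $g(f^m(x))\ge 0$ for all $m\ge N$. -/

import Mathlib

open scoped Matrix

noncomputable section

/-- The data of a single-guard affine loop
`while (bᵀ x + c ≥ 0) do x := A x + a` in `n` variables with rational coefficients. -/
structure AffineLoop (n : ℕ) where
  A : Matrix (Fin n) (Fin n) ℚ
  a : Fin n → ℚ
  b : Fin n → ℚ
  c : ℚ

namespace AffineLoop

variable {n : ℕ} (P : AffineLoop n)

/-- The update function `f(x) = A x + a` on `ℝⁿ`. -/
def f (x : Fin n → ℝ) : Fin n → ℝ :=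
  P.A.map (fun q : ℚ => (q : ℝ)) *ᵥ x + fun i => (P.a i : ℝ)

/-- The guard function `g(x) = bᵀ x + c` on `ℝⁿ`. -/
def g (x : Fin n → ℝ) : ℝ :=
  (fun i => (P.b i : ℝ)) ⬝ᵥ x + (P.c : ℝ)

/-- `x` is eventually non-terminating: the guard values along the orbit of `x` are
ultimately non-negative. -/
def EventuallyNonTerminating (x : Fin n → ℝ) : Prop :=
  ∃ N : ℕ, ∀ m : ℕ, N ≤ m → 0 ≤ P.g (P.f^[m] x)

/-- The update matrix `(A a; 0 1)`. -/
def updateMatrix : Matrix (Fin n ⊕ Unit) (Fin n ⊕ Unit) ℚ :=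
  Matrix.fromBlocks P.A (Matrix.replicateCol Unit P.a) 0 1

/-- The update matrix with its entries regarded as complex numbers. -/
def updateMatrixC : Matrix (Fin n ⊕ Unit) (Fin n ⊕ Unit) ℂ :=
  P.updateMatrix.map (fun q : ℚ => (q : ℂ))

/-- The update matrix as an endomorphism of `ℂⁿ⁺¹`. -/
def updateEnd : Module.End ℂ (Fin n ⊕ Unit → ℂ) :=
  Matrix.toLin' P.updateMatrixC

/-- `f` is non-degenerate: no quotient of two distinct (complex) eigenvalues of the update
matrix is a root of unity. -/
def NonDegenerate : Prop :=
  ∀ l₁ l₂ : ℂ, l₁ ∈ P.updateMatrixC.charpoly.roots → l₂ ∈ P.updateMatrixC.charpoly.roots →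
    l₁ ≠ l₂ → ∀ k : ℕ, 0 < k → (l₁ / l₂) ^ k ≠ 1

open scoped Classical in
/-- The finite set of non-zero complex eigenvalues of the update matrix. -/
def nonzeroEigenvalues : Finset ℂ :=
  P.updateMatrixC.charpoly.roots.toFinset.erase 0

/-- The index type of the distinct non-zero eigenvalues; the eigenvalue belonging to the
index `j` is `(j : ℂ)`. -/
abbrev EigIdx : Type := {l : ℂ // l ∈ P.nonzeroEigenvalues}

/-- The maximal algebraic multiplicity of a non-zero eigenvalue. -/
def kmax : ℕ :=
  P.nonzeroEigenvalues.sup fun l => P.updateMatrixC.charpoly.rootMultiplicity l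

/-- The index set `I = {0, …, kmax - 1} × {1, …, s}`. -/
def Idx : Type := Fin P.kmax × P.EigIdx

instance : Fintype P.Idx := inferInstanceAs (Fintype (Fin P.kmax × P.EigIdx))

/-- The dominance preorder: `(i₁, j₁) ≼ (i₂, j₂)` iff `|λ_{j₁}| < |λ_{j₂}|`, or
`|λ_{j₁}| = |λ_{j₂}|` and `i₁ ≤ i₂`. -/
instance : Preorder P.Idx where
  le p q := ‖(p.2 : ℂ)‖ < ‖(q.2 : ℂ)‖ ∨ (‖(p.2 : ℂ)‖ = ‖(q.2 : ℂ)‖ ∧ p.1 ≤ q.1)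
  le_refl p := Or.inr ⟨rfl, le_rfl⟩
  le_trans p q r := by
    rintro (h | ⟨h, h'⟩) (k | ⟨k, k'⟩)
    · exact Or.inl (h.trans k)
    · exact Or.inl (k ▸ h)
    · exact Or.inl (h ▸ k)
    · exact Or.inr ⟨h.trans k, h'.trans k'⟩

/-- The `≈`-equivalence classes of `I`, with the order induced by `≼`. -/
abbrev EqClass : Type := Antisymmetrization P.Idx (· ≤ ·)

/-- The `≈`-equivalence class of an index. -/
def cls (p : P.Idx) : P.EqClass := toAntisymmetrization (· ≤ ·) p

theorem isCompl_maxGenEigenspace {V : Type*} [AddCommGroup V] [Module ℂ V]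
    [FiniteDimensional ℂ V] (T : Module.End ℂ V) (l : ℂ) :
    IsCompl (T.maxGenEigenspace l) (⨆ k, ⨆ _ : k ≠ l, T.maxGenEigenspace k) := by
  refine ⟨T.independent_maxGenEigenspace l, ?_⟩
  rw [codisjoint_iff, eq_top_iff, ← Module.End.iSup_maxGenEigenspace_eq_top T]
  refine iSup_le fun k => ?_
  by_cases h : k = l
  · subst h
    exact le_sup_left
  · exact le_sup_of_le_right (le_iSup₂_of_le k h le_rfl)

/-- The projection of `ℂⁿ⁺¹` onto the generalised eigenspace of the update matrix for `l`
along the sum of its other generalised eigenspaces. -/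
def spectralProj (l : ℂ) : Module.End ℂ (Fin n ⊕ Unit → ℂ) :=
  Submodule.projection _ _ (isCompl_maxGenEigenspace P.updateEnd l)

/-- The vector `(x, 1)` in `ℂⁿ⁺¹`. -/
def homog {n : ℕ} (x : Fin n → ℝ) : Fin n ⊕ Unit → ℂ :=
  Sum.elim (fun i => (x i : ℂ)) fun _ => 1

/-- The linear functional `(bᵀ c)` on `ℂⁿ⁺¹`. -/
def guardC (v : Fin n ⊕ Unit → ℂ) : ℂ :=
  Sum.elim (fun i => (P.b i : ℂ)) (fun _ => (P.c : ℂ)) ⬝ᵥ v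

/-- The coefficient `h_{i,j}(x)` of `m ↦ (m choose i) * λ_j ^ m` in the closed form of
`g (f^m x)` that the Jordan-Chevalley decomposition gives: for `v = (x, 1)`, with `v_j` its
component in the generalised eigenspace of `λ_j`, one has
`M ^ m v_j = ∑ i, (m choose i) λ_j ^ (m - i) (M - λ_j) ^ i v_j`.
See `guard_iterate` below for the resulting closed form of `g (f^m x)`, `m ≥ n`. -/
def h (p : P.Idx) (x : Fin n → ℝ) : ℂ :=
  ((p.2 : ℂ) ^ (p.1 : ℕ))⁻¹ *
    P.guardC (((P.updateEnd - algebraMap ℂ _ (p.2 : ℂ)) ^ (p.1 : ℕ))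
      (P.spectralProj (p.2 : ℂ) (homog x)))

/-- The normalised eigenvalues `γ_j = λ_j / |λ_j|`. -/
def γ (j : P.EigIdx) : ℂ := (j : ℂ) / (‖(j : ℂ)‖ : ℂ)

/-- The group `L(γ)` of multiplicative relations among the `γ_j`. -/
def relations : Set (P.EigIdx → ℤ) :=
  {v | ∏ j, P.γ j ^ v j = 1}

/-- The subset `T(γ)` of the torus: the tuples of complex numbers of modulus one that satisfy
every multiplicative relation that holds among the `γ_j`. -/
def torus : Set (P.EigIdx → ℂ) :=
  {μ | (∀ j, ‖μ j‖ = 1) ∧ ∀ v ∈ P.relations, ∏ j, μ j ^ v j = 1}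

open scoped Classical in
/-- `Φ_E(x, μ) = ∑_{(i,j) ∈ E} h_{i,j}(x) μ_j` for an equivalence class `E`. This sum is real
for `μ ∈ T(γ)` (see `Φ_eq` below); the real part makes it a real number in Lean. -/
def Φ (E : P.EqClass) (x : Fin n → ℝ) (μ : P.EigIdx → ℂ) : ℝ :=
  (∑ p : P.Idx with P.cls p = E, P.h p x * μ p.2).re

/-- The class `E` is dominant for `x`: all `h_{i,j}(x)` with `(i, j)` in a class strictly above
`E` vanish. -/
def IsDominant (E : P.EqClass) (x : Fin n → ℝ) : Prop :=
  ∀ p : P.Idx, E < P.cls p → P.h p x = 0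

/-- The set of potentially non-terminating points. The condition is imposed for every class `E`
that is dominant for `x`; since `Φ_{E'}(x, ·) = 0` for the classes `E'` above the least dominant
class, this is the condition for the least dominant class (see `mem_PN_iff_of_isLeast` below). -/
def PN : Set (Fin n → ℝ) :=
  {x | ∀ E : P.EqClass, P.IsDominant E x → 0 ≤ ⨅ μ : P.torus, P.Φ E x μ}

section

open Polynomial

theorem pow_rootMultiplicity_apply {V : Type*} [AddCommGroup V] [Module ℂ V]
    [FiniteDimensional ℂ V] (T : Module.End ℂ V) (l : ℂ) {v : V}
    (hv : v ∈ T.maxGenEigenspace l) {k : ℕ} (hk : T.charpoly.rootMultiplicity l ≤ k) :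
    ((T - algebraMap ℂ _ l) ^ k) v = 0 := by
  have hm : ∀ x ∈ T.maxGenEigenspace l,
      (T - algebraMap ℂ (Module.End ℂ V) l) x ∈ T.maxGenEigenspace l :=
    Module.End.mapsTo_maxGenEigenspace_of_comm (Algebra.mul_sub_algebraMap_commutes T l) l
  have hN := Module.End.isNilpotent_restrict_maxGenEigenspace_sub_algebraMap T l hm
  have h0 := LinearMap.aeval_self_charpoly (LinearMap.restrict _ hm)
  rw [hN.charpoly_eq_X_pow_finrank, T.finrank_maxGenEigenspace_eq, map_pow, aeval_X] at h0
  have h1 : ((LinearMap.restrict _ hm) ^ k) (⟨v, hv⟩ : T.maxGenEigenspace l) = 0 := by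
    rw [← Nat.sub_add_cancel hk, pow_add, h0, mul_zero, LinearMap.zero_apply]
  rw [Module.End.pow_restrict k] at h1
  exact congrArg Subtype.val h1

theorem updateEnd_homog (x : Fin n → ℝ) : P.updateEnd (homog x) = homog (P.f x) := by
  ext i
  rcases i with i | i <;>
    simp [updateEnd, updateMatrixC, updateMatrix, homog, f, Matrix.mulVec, dotProduct,
      Matrix.fromBlocks]

theorem guardC_homog (x : Fin n → ℝ) : P.guardC (homog x) = (P.g x : ℂ) := by
  simp [guardC, homog, g, dotProduct]

theorem rootMultiplicity_zero_le : P.updateEnd.charpoly.rootMultiplicity 0 ≤ n := by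
  have hch : P.updateEnd.charpoly =
      (P.A.map (fun q : ℚ => (q : ℂ))).charpoly * (X - C 1) := by
    have hM : P.updateMatrixC = Matrix.fromBlocks (P.A.map (fun q : ℚ => (q : ℂ)))
        ((Matrix.replicateCol Unit P.a).map (fun q : ℚ => (q : ℂ))) 0 1 := by
      rw [updateMatrixC, updateMatrix, Matrix.fromBlocks_map]
      congr 1
      · ext; simp
      · ext i j; simp
    rw [updateEnd, Matrix.charpoly_toLin', hM, Matrix.charpoly_fromBlocks_zero₂₁]
    congr 1
    simp [Matrix.charpoly_one]
  have hm := (Matrix.charpoly_monic (P.A.map (fun q : ℚ => (q : ℂ))))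
  rw [hch, rootMultiplicity_mul (hm.mul (monic_X_sub_C 1)).ne_zero,
    rootMultiplicity_X_sub_C]
  simp only [zero_ne_one, if_false, add_zero]
  refine (count_roots _).symm.le.trans ((Multiset.count_le_card _ _).trans ?_)
  simpa using card_roots' (P.A.map (fun q : ℚ => (q : ℂ))).charpoly

theorem spectralProj_of_mem {l : ℂ} {v : Fin n ⊕ Unit → ℂ}
    (hv : v ∈ P.updateEnd.maxGenEigenspace l) : P.spectralProj l v = v :=
  Submodule.projection_apply_of_mem_left _ hv

theorem spectralProj_of_mem_ne {k l : ℂ} (hkl : k ≠ l) {v : Fin n ⊕ Unit → ℂ}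
    (hv : v ∈ P.updateEnd.maxGenEigenspace k) : P.spectralProj l v = 0 :=
  Submodule.projection_apply_of_mem_right _
    (Submodule.mem_iSup_of_mem k (Submodule.mem_iSup_of_mem hkl hv))

theorem pow_updateEnd_apply (m : ℕ) (hm : n ≤ m) (v : Fin n ⊕ Unit → ℂ) :
    (P.updateEnd ^ m) v = ∑ p : P.Idx, ((m.choose p.1 : ℂ) * (p.2 : ℂ) ^ m) •
      (((p.2 : ℂ) ^ (p.1 : ℕ))⁻¹ • ((P.updateEnd - algebraMap ℂ _ (p.2 : ℂ)) ^ (p.1 : ℕ))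
        (P.spectralProj (p.2 : ℂ) v)) := by
  have hv : v ∈ ⨆ l, P.updateEnd.maxGenEigenspace l := by
    rw [Module.End.iSup_maxGenEigenspace_eq_top]; trivial
  induction hv using Submodule.iSup_induction' with
  | zero => simp
  | add x y _ _ hx hy => simp only [map_add, smul_add, Finset.sum_add_distrib, hx, hy]
  | mem l x hx =>
    have hself : P.spectralProj l x = x := P.spectralProj_of_mem hx
    have hother : ∀ k, k ≠ l → P.spectralProj k x = 0 := fun k hk =>
      P.spectralProj_of_mem_ne hk.symm hx
    change _ = ∑ p : Fin P.kmax × P.EigIdx, _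
    rw [Fintype.sum_prod_type_right]
    by_cases hl : l ∈ P.nonzeroEigenvalues
    · have hl0 : l ≠ 0 := by
        classical
        exact (Finset.mem_erase.1 hl).1
      rw [Finset.sum_eq_single (⟨l, hl⟩ : P.EigIdx)]
      · simp only [hself]
        have hk : P.updateEnd.charpoly.rootMultiplicity l ≤ P.kmax := by
          rw [updateEnd, Matrix.charpoly_toLin']
          exact Finset.le_sup (f := fun l => P.updateMatrixC.charpoly.rootMultiplicity l) hl
        set N := P.updateEnd - algebraMap ℂ _ l with hN
        have hT : P.updateEnd = N + algebraMap ℂ _ l := by rw [hN, sub_add_cancel]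
        have hc : Commute N (algebraMap ℂ (Module.End ℂ (Fin n ⊕ Unit → ℂ)) l) :=
          (Algebra.commutes l N).symm
        rw [hT, hc.add_pow, LinearMap.sum_apply, Fin.sum_univ_eq_sum_range (fun i =>
          ((m.choose i : ℂ) * l ^ m) • ((l ^ i)⁻¹ • (N ^ i) x))]
        have e1 : ∀ K, (∀ i, K ≤ i → m.choose i = 0 ∨ (N ^ i) x = 0) →
            ∀ K', K ≤ K' → ∑ i ∈ Finset.range K, ((m.choose i : ℂ) * l ^ m) •
              ((l ^ i)⁻¹ • (N ^ i) x) = ∑ i ∈ Finset.range K', ((m.choose i : ℂ) * l ^ m) •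
              ((l ^ i)⁻¹ • (N ^ i) x) := by
          intro K hK K' hKK'
          refine Finset.sum_subset (Finset.range_mono hKK') fun i _ hi => ?_
          rcases hK i (by simpa using hi) with h | h <;> simp [h]
        rw [e1 P.kmax (fun i hi => Or.inr (pow_rootMultiplicity_apply _ _ hx (hk.trans hi)))
          (max P.kmax (m + 1)) (le_max_left _ _),
          ← e1 (m + 1) (fun i hi => Or.inl (Nat.choose_eq_zero_of_lt hi)) _ (le_max_right _ _)]
        refine Finset.sum_congr rfl fun i hi => ?_
        have hi' : i ≤ m := by simpa [Nat.lt_succ_iff] using hi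
        have e2 : l ^ m * (l ^ i)⁻¹ = l ^ (m - i) := by
          rw [pow_sub₀ _ hl0 hi']
        rw [smul_smul, mul_assoc ((m.choose i : ℂ)), e2, ← map_pow,
          ← map_natCast (algebraMap ℂ (Module.End ℂ (Fin n ⊕ Unit → ℂ))), mul_assoc, ← map_mul,
          ← Algebra.commutes, ← Algebra.smul_def, LinearMap.smul_apply, mul_comm (l ^ (m - i))]
      · intro k _ hk
        refine Finset.sum_eq_zero fun i _ => ?_
        rw [hother k (fun h => hk (Subtype.ext h))]
        simp
      · simp
    · rw [Finset.sum_eq_zero]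
      · have hmult : P.updateEnd.charpoly.rootMultiplicity l ≤ m ∧ l = 0 ∨ x = 0 := by
          by_cases hl0 : l = 0
          · subst hl0
            exact Or.inl ⟨P.rootMultiplicity_zero_le.trans hm, rfl⟩
          · right
            have hr : ¬ P.updateEnd.charpoly.IsRoot l := by
              intro hr
              apply hl
              classical
              rw [updateEnd, Matrix.charpoly_toLin'] at hr
              simp only [nonzeroEigenvalues, Finset.mem_erase, Multiset.mem_toFinset]
              exact ⟨hl0, (mem_roots (Matrix.charpoly_monic _).ne_zero).2 hr⟩
            simpa using pow_rootMultiplicity_apply _ l hx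
              (rootMultiplicity_eq_zero hr).le
        rcases hmult with ⟨h, rfl⟩ | rfl
        · simpa using pow_rootMultiplicity_apply _ 0 hx h
        · simp
      · intro k _
        refine Finset.sum_eq_zero fun i _ => ?_
        rw [hother k (fun h => hl (h ▸ k.2))]
        simp

/-- The closed form of the guard values along an orbit. -/
theorem guard_iterate (x : Fin n → ℝ) (m : ℕ) (hm : n ≤ m) :
    (P.g (P.f^[m] x) : ℂ) =
      ∑ p : P.Idx, (m.choose p.1 : ℂ) * (p.2 : ℂ) ^ m * P.h p x := by
  have h1 : ∀ m : ℕ, homog (P.f^[m] x) = (P.updateEnd ^ m) (homog x) := by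
    intro m
    induction m with
    | zero => simp
    | succ m ih => rw [Function.iterate_succ_apply', ← updateEnd_homog, ih, pow_succ']; rfl
  rw [← guardC_homog, h1, P.pow_updateEnd_apply m hm]
  simp only [guardC, h, dotProduct_sum, dotProduct_smul, smul_eq_mul]

/-- The infimum in the definition of `PN` is non-negative iff all the values are. -/
theorem iInf_Φ_nonneg_iff (E : P.EqClass) (x : Fin n → ℝ) :
    (0 ≤ ⨅ μ : P.torus, P.Φ E x μ) ↔ ∀ μ ∈ P.torus, 0 ≤ P.Φ E x μ := by
  classical
  refine ⟨fun h μ hμ => h.trans (ciInf_le ?_ (⟨μ, hμ⟩ : P.torus)),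
    fun h => Real.iInf_nonneg fun μ => h μ μ.2⟩
  refine ⟨-∑ p : P.Idx with P.cls p = E, ‖P.h p x‖, ?_⟩
  rintro _ ⟨μ, rfl⟩
  refine (abs_le.1 ((Complex.abs_re_le_norm _).trans ((norm_sum_le _ _).trans ?_))).1
  exact Finset.sum_le_sum fun p _ => by rw [norm_mul, μ.2.1, mul_one]

theorem updateEnd_star (v : Fin n ⊕ Unit → ℂ) :
    P.updateEnd (star v) = star (P.updateEnd v) := by
  ext i
  simp [updateEnd, updateMatrixC, Matrix.mulVec, dotProduct]

theorem sub_pow_star (l : ℂ) (i : ℕ) (v : Fin n ⊕ Unit → ℂ) :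
    ((P.updateEnd - algebraMap ℂ _ (star l)) ^ i) (star v) =
      star (((P.updateEnd - algebraMap ℂ _ l) ^ i) v) := by
  induction i with
  | zero => simp
  | succ i ih =>
    rw [pow_succ', pow_succ', Module.End.mul_apply, ih, Module.End.mul_apply]
    simp [updateEnd_star, Module.algebraMap_end_apply]

theorem star_mem_maxGenEigenspace {l : ℂ} {v : Fin n ⊕ Unit → ℂ}
    (hv : v ∈ P.updateEnd.maxGenEigenspace l) :
    star v ∈ P.updateEnd.maxGenEigenspace (star l) := by
  rw [Module.End.mem_maxGenEigenspace] at hv ⊢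
  obtain ⟨k, hk⟩ := hv
  refine ⟨k, ?_⟩
  rw [← Algebra.algebraMap_eq_smul_one] at hk ⊢
  rw [sub_pow_star, hk, star_zero]

theorem spectralProj_star (l : ℂ) (v : Fin n ⊕ Unit → ℂ) :
    P.spectralProj (star l) (star v) = star (P.spectralProj l v) := by
  have hv : v ∈ ⨆ l, P.updateEnd.maxGenEigenspace l := by
    rw [Module.End.iSup_maxGenEigenspace_eq_top]; trivial
  induction hv using Submodule.iSup_induction' with
  | zero => simp
  | add x y _ _ hx hy => simp only [map_add, star_add, hx, hy]
  | mem k x hx =>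
    by_cases h : k = l
    · subst h
      rw [P.spectralProj_of_mem hx, P.spectralProj_of_mem (P.star_mem_maxGenEigenspace hx)]
    · rw [P.spectralProj_of_mem_ne h hx, P.spectralProj_of_mem_ne
        (fun e => h (star_injective e)) (P.star_mem_maxGenEigenspace hx), star_zero]

theorem star_mem_nonzeroEigenvalues {l : ℂ} (hl : l ∈ P.nonzeroEigenvalues) :
    star l ∈ P.nonzeroEigenvalues := by
  classical
  have hM : P.updateMatrixC.map (starRingEnd ℂ) = P.updateMatrixC := by
    ext i j
    simp [updateMatrixC]
  simp only [nonzeroEigenvalues, Finset.mem_erase, Multiset.mem_toFinset,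
    mem_roots (Matrix.charpoly_monic P.updateMatrixC).ne_zero] at hl ⊢
  refine ⟨fun h => hl.1 (by simpa using h), ?_⟩
  have := IsRoot.map (f := starRingEnd ℂ) hl.2
  rwa [← Matrix.charpoly_map, hM] at this

/-- The index of the complex conjugate eigenvalue. -/
def conjIdx (j : P.EigIdx) : P.EigIdx := ⟨star (j : ℂ), P.star_mem_nonzeroEigenvalues j.2⟩

theorem h_conj (i : Fin P.kmax) (j : P.EigIdx) (x : Fin n → ℝ) :
    P.h (i, P.conjIdx j) x = star (P.h (i, j) x) := by
  have hx : homog x = star (homog x) := by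
    ext k
    rcases k with k | k <;> simp [homog]
  have hg : ∀ v, P.guardC (star v) = star (P.guardC v) := by
    intro v
    simp [guardC, dotProduct]
  simp only [h, conjIdx]
  have h1 : P.spectralProj (star (j : ℂ)) (homog x) = star (P.spectralProj (j : ℂ) (homog x)) := by
    rw [← spectralProj_star, ← hx]
  rw [h1, sub_pow_star, hg, star_mul', star_inv₀, star_pow]

theorem torus_conj {μ : P.EigIdx → ℂ} (hμ : μ ∈ P.torus) (j : P.EigIdx) :
    μ (P.conjIdx j) = star (μ j) := by
  classical
  have key : ∀ ν : P.EigIdx → ℂ, (∀ j, ‖ν j‖ = 1) →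
      ∏ k, ν k ^ ((Pi.single j 1 + Pi.single (P.conjIdx j) 1 : P.EigIdx → ℤ) k) =
        ν j * ν (P.conjIdx j) := by
    intro ν hν
    have h0 : ∀ k, ν k ≠ 0 := fun k h => by simpa [h] using hν k
    have h1 : ∀ j, ∏ k, ν k ^ ((Pi.single j 1 : P.EigIdx → ℤ) k) = ν j := by
      intro j
      rw [Finset.prod_eq_single j]
      · simp
      · intro k _ hk
        simp [hk]
      · simp
    simp only [Pi.add_apply, zpow_add₀ (h0 _), Finset.prod_mul_distrib, h1]
  have hj0 : ∀ j : P.EigIdx, (j : ℂ) ≠ 0 := fun j => (Finset.mem_erase.1 j.2).1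
  have hγ : ∀ j, ‖P.γ j‖ = 1 := by
    intro j
    simp [γ, hj0 j]
  have h2 := hμ.2 (Pi.single j 1 + Pi.single (P.conjIdx j) 1) (by
    change _ = _
    rw [key _ hγ]
    have : P.γ (P.conjIdx j) = starRingEnd ℂ (P.γ j) := by simp [γ, conjIdx]
    rw [this, Complex.mul_conj, Complex.normSq_eq_norm_sq, hγ]
    simp)
  rw [key _ hμ.1] at h2
  have h3 : μ j * star (μ j) = 1 := by
    rw [Complex.star_def, Complex.mul_conj, Complex.normSq_eq_norm_sq, hμ.1]
    simp
  have h4 : μ j ≠ 0 := fun h => by simp [h] at h3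
  exact mul_left_cancel₀ h4 (h2.trans h3.symm)

open scoped Classical in
/-- The sum in the definition of `Φ` is real on `T(γ)`. -/
theorem Φ_eq (E : P.EqClass) (x : Fin n → ℝ) {μ : P.EigIdx → ℂ} (hμ : μ ∈ P.torus) :
    (P.Φ E x μ : ℂ) = ∑ p : P.Idx with P.cls p = E, P.h p x * μ p.2 := by
  rw [Φ, ← Complex.conj_eq_iff_re, map_sum]
  let σ : P.Idx → P.Idx := fun p => (p.1, P.conjIdx p.2)
  have hσ : ∀ p, σ (σ p) = p := fun p => Prod.ext rfl (Subtype.ext (star_star (p.2 : ℂ)))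
  have hc : ∀ p, P.cls (σ p) = P.cls p := fun p => by
    apply Quotient.sound
    constructor <;> right <;> simp [σ, conjIdx]
  refine Finset.sum_nbij' σ σ ?_ ?_ (fun p _ => hσ p) (fun p _ => hσ p) ?_
  · intro p hp
    simpa [hc] using hp
  · intro p hp
    simpa [hc] using hp
  · rintro ⟨i, j⟩ _
    change _ = P.h (i, P.conjIdx j) x * μ (P.conjIdx j)
    rw [h_conj, torus_conj P hμ, map_mul]
    rfl

/-- For the least class `E` that is dominant for `x`, membership in `PN` is the condition
on `Φ_E` alone. -/
theorem mem_PN_iff_of_isLeast {E : P.EqClass} {x : Fin n → ℝ}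
    (hE : IsLeast {E | P.IsDominant E x} E) :
    x ∈ P.PN ↔ 0 ≤ ⨅ μ : P.torus, P.Φ E x μ := by
  classical
  refine ⟨fun hx => hx E hE.1, fun hx E' hE' => ?_⟩
  rcases (hE.2 hE').eq_or_lt with rfl | hlt
  · exact hx
  · rw [iInf_Φ_nonneg_iff]
    intro μ _
    rw [Φ, Finset.sum_eq_zero, Complex.zero_re]
    intro p hp
    have hp' : P.cls p = E' := by simpa using hp
    rw [hE.1 p (hp' ▸ hlt), zero_mul]

end

end AffineLoop

end

open Filter Topology Asymptotics

namespace AffineLoop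

variable {n : ℕ} (P : AffineLoop n)

/-! ### Power sums -/

/-! If all `h p z` vanish, they vanish on the whole orbit and its hull, where the guard is
ultimately zero. Otherwise let `E` be the class of a maximal index `p₀` with `h p₀ z ≠ 0`; it is
dominant for `z`. One step of the loop multiplies each coefficient in `E` by its eigenvalue, since
the Jordan corrections are coefficients above `E`. Hence `Φ E (f^m z) μ` is a non-negative multiple
of `Φ E z (γ^m μ)`, and membership in `PN` makes `Φ E` non-negative on the torus at every orbit
point and, by convexity, on the hull (`IsDominant.Φ_iterate`).

For fixed `μ`, not all orbit values `Φ E (f^m z) μ` are zero: they are power sums in distinct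
eigenvalues, so a Vandermonde argument would give `h p₀ z = 0`
(`IsDominant.exists_Φ_iterate_ne_zero`). A relatively interior `x` gives positive weight to any
chosen orbit point, the rest lying in the hull, so `Φ E x μ > 0`. As the torus is compact, `Φ E x`
is bounded below by a positive constant, which outweighs the lower-order terms of the guard
(`IsDominant.eventuallyNonTerminating`). -/

theorem eq_zero_of_forall_sum_mul_pow_eq_zero {K ι : Type*} [Field K] (s : Finset ι)
    (c v : ι → K) (hv : Set.InjOn v s) (h : ∀ m : ℕ, ∑ i ∈ s, c i * v i ^ m = 0) :
    ∀ i ∈ s, c i = 0 := by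
  classical
  -- By linearity the relations extend from monomials to all polynomials; a Lagrange basis
  -- polynomial then isolates one coefficient.
  have hpoly : ∀ q : Polynomial K, ∑ i ∈ s, c i * q.eval (v i) = 0 := by
    intro q
    simp only [Polynomial.eval_eq_sum_range, Finset.mul_sum]
    rw [Finset.sum_comm]
    refine Finset.sum_eq_zero fun k _ => ?_
    have := congrArg (fun t => q.coeff k * t) (h k)
    simp only [Finset.mul_sum, mul_zero] at this
    rw [← this]
    exact Finset.sum_congr rfl fun i _ => by ring
  intro i hi
  have h1 := hpoly (Lagrange.basis s v i)
  rw [Finset.sum_eq_single i, Lagrange.eval_basis_self hv hi, mul_one] at h1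
  · exact h1
  · intro j hj hji
    rw [Lagrange.eval_basis_of_ne hji.symm hj, mul_zero]
  · exact fun h => absurd hi h

/-! ### Relative interiors -/

/-- The segment from `y` to `x` can be prolonged slightly beyond `x` without leaving `s`; `w` is the
new endpoint. -/
theorem exists_combo_of_mem_intrinsicInterior {V : Type*} [NormedAddCommGroup V]
    [NormedSpace ℝ V] {s : Set V} {x y : V} (hx : x ∈ intrinsicInterior ℝ s) (hy : y ∈ s) :
    ∃ w ∈ s, ∃ t : ℝ, 0 < t ∧ t < 1 ∧ x = t • y + (1 - t) • w := by
  obtain ⟨x', hx', rfl⟩ := hx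
  let c : ℝ → affineSpan ℝ s := fun t =>
    ⟨AffineMap.lineMap (x' : V) y (-t), AffineMap.lineMap_mem _ x'.2 (subset_affineSpan ℝ s hy)⟩
  have hc : Continuous c := by
    refine Continuous.subtype_mk ?_ _
    exact AffineMap.lineMap_continuous.comp continuous_neg
  have hc0 : c 0 = x' := Subtype.ext (by simp [c])
  have hmem : ∀ᶠ t in 𝓝 (0 : ℝ), (c t : V) ∈ s := by
    refine hc.continuousAt.eventually_mem (f := c) (s := ((↑) ⁻¹' s : Set (affineSpan ℝ s))) ?_
    rw [hc0]
    exact mem_interior_iff_mem_nhds.1 hx'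
  obtain ⟨t, ht, ht0⟩ := ((hmem.filter_mono nhdsWithin_le_nhds).and
    (self_mem_nhdsWithin : Set.Ioi (0 : ℝ) ∈ 𝓝[>] 0)).exists
  have ht0 : 0 < t := ht0
  have h1t : (1 + t) ≠ 0 := by positivity
  -- The weight comes from solving `w = (1 + t) x - t y` for `x`.
  refine ⟨c t, ht, t / (1 + t), by positivity, (div_lt_one (by positivity)).2 (by linarith), ?_⟩
  have e : (1 : ℝ) - t / (1 + t) = (1 + t)⁻¹ := by field_simp; ring
  have e2 : (c t : V) = (1 + t) • (x' : V) - t • y := by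
    simp only [c, AffineMap.lineMap_apply_module]
    module
  rw [e, e2, smul_sub, smul_smul, smul_smul, inv_mul_cancel₀ h1t, one_smul, div_eq_inv_mul]
  abel

/-! ### The dominance preorder -/

theorem idx_le_iff {p q : P.Idx} : p ≤ q ↔
    ‖(p.2 : ℂ)‖ < ‖(q.2 : ℂ)‖ ∨ (‖(p.2 : ℂ)‖ = ‖(q.2 : ℂ)‖ ∧ p.1 ≤ q.1) := Iff.rfl

theorem idx_lt_iff {p q : P.Idx} : p < q ↔
    ‖(p.2 : ℂ)‖ < ‖(q.2 : ℂ)‖ ∨ (‖(p.2 : ℂ)‖ = ‖(q.2 : ℂ)‖ ∧ p.1 < q.1) := by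
  rw [lt_iff_le_not_ge, idx_le_iff, idx_le_iff]
  constructor
  · rintro ⟨h | ⟨h, h'⟩, hn⟩
    · exact Or.inl h
    · refine Or.inr ⟨h, lt_of_not_ge fun h2 => hn (Or.inr ⟨h.symm, h2⟩)⟩
  · rintro (h | ⟨h, h'⟩)
    · refine ⟨Or.inl h, ?_⟩
      rintro (k | ⟨k, -⟩) <;> linarith
    · refine ⟨Or.inr ⟨h, h'.le⟩, ?_⟩
      rintro (k | ⟨-, k⟩)
      · linarith
      · exact absurd h' (not_lt.2 k)

theorem cls_lt_cls_iff {p q : P.Idx} : P.cls p < P.cls q ↔ p < q := Iff.rfl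

theorem cls_eq_cls_iff {p q : P.Idx} : P.cls p = P.cls q ↔
    ‖(p.2 : ℂ)‖ = ‖(q.2 : ℂ)‖ ∧ p.1 = q.1 := by
  have h : P.cls p = P.cls q ↔ p ≤ q ∧ q ≤ p := Quotient.eq''
  rw [h, idx_le_iff, idx_le_iff]
  constructor
  · rintro ⟨h | ⟨h, h'⟩, k | ⟨k, k'⟩⟩
    · linarith
    · linarith
    · linarith
    · exact ⟨h, le_antisymm h' k'⟩
  · rintro ⟨h, k⟩
    exact ⟨Or.inr ⟨h, k.le⟩, Or.inr ⟨h.symm, k.ge⟩⟩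

theorem cls_trichotomy (p q : P.Idx) : p < q ∨ P.cls p = P.cls q ∨ q < p := by
  rw [idx_lt_iff, idx_lt_iff, cls_eq_cls_iff]
  rcases lt_trichotomy ‖(p.2 : ℂ)‖ ‖(q.2 : ℂ)‖ with h | h | h
  · exact Or.inl (Or.inl h)
  · rcases lt_trichotomy p.1 q.1 with k | k | k
    · exact Or.inl (Or.inr ⟨h, k⟩)
    · exact Or.inr (Or.inl ⟨h, k⟩)
    · exact Or.inr (Or.inr (Or.inr ⟨h.symm, k⟩))
  · exact Or.inr (Or.inr (Or.inl h))

theorem eigIdx_ne_zero (j : P.EigIdx) : (j : ℂ) ≠ 0 := by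
  classical
  exact (Finset.mem_erase.1 j.2).1

/-! ### The coefficients along an orbit -/

theorem spectralProj_updateEnd (l : ℂ) (v : Fin n ⊕ Unit → ℂ) :
    P.spectralProj l (P.updateEnd v) = P.updateEnd (P.spectralProj l v) := by
  have hv : v ∈ ⨆ l, P.updateEnd.maxGenEigenspace l := by
    rw [Module.End.iSup_maxGenEigenspace_eq_top]; trivial
  induction hv using Submodule.iSup_induction' with
  | zero => simp
  | add x y _ _ hx hy => simp only [map_add, hx, hy]
  | mem k x hx =>
    have hx' : P.updateEnd x ∈ P.updateEnd.maxGenEigenspace k :=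
      Module.End.mapsTo_maxGenEigenspace_of_comm (Commute.refl P.updateEnd) k hx
    by_cases h : k = l
    · subst h
      rw [P.spectralProj_of_mem hx, P.spectralProj_of_mem hx']
    · rw [P.spectralProj_of_mem_ne h hx, P.spectralProj_of_mem_ne h hx', map_zero]

theorem spectralProj_mem (l : ℂ) (v : Fin n ⊕ Unit → ℂ) :
    P.spectralProj l v ∈ P.updateEnd.maxGenEigenspace l :=
  Submodule.projection_apply_mem _ v

theorem guardC_add (v w : Fin n ⊕ Unit → ℂ) :
    P.guardC (v + w) = P.guardC v + P.guardC w := dotProduct_add _ _ _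

theorem guardC_smul (r : ℂ) (v : Fin n ⊕ Unit → ℂ) :
    P.guardC (r • v) = r * P.guardC v := dotProduct_smul _ _ _

/-- A coefficient above which all coefficients vanish is multiplied by the eigenvalue in each
step of the loop. -/
theorem h_f_of_forall_lt {p : P.Idx} {x : Fin n → ℝ} (hp : ∀ q, p < q → P.h q x = 0) :
    P.h p (P.f x) = (p.2 : ℂ) * P.h p x := by
  obtain ⟨i, j⟩ := p
  have hj := P.eigIdx_ne_zero j
  set N := P.updateEnd - algebraMap ℂ _ (j : ℂ) with hN
  set v := P.spectralProj (j : ℂ) (homog x) with hv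
  -- Up to a non-zero factor this is the coefficient at `(i + 1, j)`, which lies above `p`. If `i +
  -- 1 = kmax` there is no such index, but then the power of `N` already kills the generalised
  -- eigenspace.
  have hzero : P.guardC ((N ^ ((i : ℕ) + 1)) v) = 0 := by
    by_cases hi : (i : ℕ) + 1 < P.kmax
    · have h0 := hp (⟨i + 1, hi⟩, j)
        ((P.idx_lt_iff).2 (Or.inr ⟨rfl, Fin.lt_def.2 (Nat.lt_succ_self _)⟩))
      simp only [h, mul_eq_zero, inv_eq_zero, pow_eq_zero_iff', hj, false_and, false_or] at h0
      exact h0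
    · have hk : P.updateEnd.charpoly.rootMultiplicity (j : ℂ) ≤ P.kmax := by
        rw [updateEnd, Matrix.charpoly_toLin']
        exact Finset.le_sup (f := fun l => P.updateMatrixC.charpoly.rootMultiplicity l) j.2
      rw [pow_rootMultiplicity_apply _ _ (P.spectralProj_mem _ _) (hk.trans (not_lt.1 hi))]
      exact dotProduct_zero _
  have hstep : (N ^ (i : ℕ)) (P.updateEnd v) =
      (N ^ ((i : ℕ) + 1)) v + (j : ℂ) • (N ^ (i : ℕ)) v := by
    have : P.updateEnd v = N v + (j : ℂ) • v := by
      rw [hN, LinearMap.sub_apply, Module.algebraMap_end_apply, sub_add_cancel]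
    rw [this, map_add, map_smul, pow_succ]
    rfl
  change ((j : ℂ) ^ (i : ℕ))⁻¹ * P.guardC ((N ^ (i : ℕ)) (P.spectralProj (j : ℂ) (homog (P.f x))))
    = (j : ℂ) * (((j : ℂ) ^ (i : ℕ))⁻¹ * P.guardC ((N ^ (i : ℕ)) v))
  rw [← updateEnd_homog, spectralProj_updateEnd, ← hv, hstep, guardC_add, hzero, guardC_smul]
  ring

theorem h_combo (p : P.Idx) (x y : Fin n → ℝ) {s t : ℝ} (hst : s + t = 1) :
    P.h p (s • x + t • y) = s * P.h p x + t * P.h p y := by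
  have e : homog (s • x + t • y) = (s : ℂ) • homog x + (t : ℂ) • homog y := by
    ext k
    rcases k with k | k
    · simp [homog]
    · simp [homog, ← Complex.ofReal_add, hst]
  simp only [h, e, map_add, map_smul, guardC_add, guardC_smul]
  ring

theorem Φ_combo (E : P.EqClass) (x y : Fin n → ℝ) (μ : P.EigIdx → ℂ) {s t : ℝ}
    (hst : s + t = 1) :
    P.Φ E (s • x + t • y) μ = s * P.Φ E x μ + t * P.Φ E y μ := by
  simp only [Φ, ← Complex.re_ofReal_mul, ← Complex.add_re, Finset.mul_sum,
    ← Finset.sum_add_distrib]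
  congr 1
  refine Finset.sum_congr rfl fun p _ => ?_
  rw [P.h_combo p x y hst]
  ring

variable {P}

theorem IsDominant.combo {E : P.EqClass} {x y : Fin n → ℝ} (hx : P.IsDominant E x)
    (hy : P.IsDominant E y) {s t : ℝ} (hst : s + t = 1) : P.IsDominant E (s • x + t • y) := by
  intro p hp
  rw [P.h_combo p x y hst, hx p hp, hy p hp, mul_zero, mul_zero, add_zero]

theorem IsDominant.h_f {E : P.EqClass} {x : Fin n → ℝ} (hx : P.IsDominant E x) {p : P.Idx}
    (hp : E ≤ P.cls p) : P.h p (P.f x) = (p.2 : ℂ) * P.h p x :=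
  P.h_f_of_forall_lt fun q hq => hx q (hp.trans_lt (P.cls_lt_cls_iff.2 hq))

theorem IsDominant.f {E : P.EqClass} {x : Fin n → ℝ} (hx : P.IsDominant E x) :
    P.IsDominant E (P.f x) := fun p hp => by
  rw [hx.h_f hp.le, hx p hp, mul_zero]

theorem IsDominant.iterate {E : P.EqClass} {x : Fin n → ℝ} (hx : P.IsDominant E x) (m : ℕ) :
    P.IsDominant E (P.f^[m] x) := by
  induction m with
  | zero => exact hx
  | succ m ih => rw [Function.iterate_succ_apply']; exact ih.f

theorem IsDominant.h_iterate {E : P.EqClass} {x : Fin n → ℝ} (hx : P.IsDominant E x)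
    {p : P.Idx} (hp : E ≤ P.cls p) (m : ℕ) :
    P.h p (P.f^[m] x) = (p.2 : ℂ) ^ m * P.h p x := by
  induction m with
  | zero => simp
  | succ m ih =>
    rw [Function.iterate_succ_apply', (hx.iterate m).h_f hp, ih]
    ring

variable (P)

/-! ### The torus -/

theorem norm_γ (j : P.EigIdx) : ‖P.γ j‖ = 1 := by
  simp [γ, P.eigIdx_ne_zero j]

theorem norm_mul_γ (j : P.EigIdx) : (‖(j : ℂ)‖ : ℂ) * P.γ j = j := by
  have : (‖(j : ℂ)‖ : ℂ) ≠ 0 := by simpa using P.eigIdx_ne_zero j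
  rw [γ, mul_div_cancel₀ _ this]

theorem one_mem_torus : (1 : P.EigIdx → ℂ) ∈ P.torus :=
  ⟨fun _ => by simp, fun v _ => by simp⟩

/-- The torus is closed under products, and `γ` itself satisfies all the defining relations. -/
theorem γ_pow_mul_mem_torus {μ : P.EigIdx → ℂ} (hμ : μ ∈ P.torus) (m : ℕ) :
    (fun j => P.γ j ^ m * μ j) ∈ P.torus := by
  refine ⟨fun j => by rw [norm_mul, norm_pow, norm_γ, hμ.1, one_pow, mul_one], fun v hv => ?_⟩
  have hv' : ∏ j, P.γ j ^ v j = 1 := hv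
  have e : ∀ j, (P.γ j ^ m) ^ v j = (P.γ j ^ v j) ^ m := fun j => by
    rw [← zpow_natCast, ← zpow_natCast, zpow_comm]
  simp only [mul_zpow, Finset.prod_mul_distrib, hμ.2 v hv, e, Finset.prod_pow, hv', one_pow,
    mul_one]

theorem γ_pow_mem_torus (m : ℕ) : (fun j => P.γ j ^ m) ∈ P.torus := by
  simpa using P.γ_pow_mul_mem_torus P.one_mem_torus m

theorem isCompact_torus : IsCompact P.torus := by
  classical
  refine Metric.isCompact_of_isClosed_isBounded ?_ ?_
  · have e : P.torus = {μ : P.EigIdx → ℂ | ∀ j, ‖μ j‖ = 1} ∩ ⋂ v ∈ P.relations,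
        {μ | ∏ j, μ j ^ (v j).toNat = ∏ j, μ j ^ (-v j).toNat} := by
      ext μ
      simp only [torus, Set.mem_ofPred_eq, Set.mem_inter_iff, Set.mem_iInter]
      refine and_congr_right fun hμ => forall₂_congr fun v _ => ?_
      have h0 : ∀ j, μ j ≠ 0 := fun j h => by simpa [h] using hμ j
      have e : ∀ j, μ j ^ v j = μ j ^ (v j).toNat / μ j ^ (-v j).toNat := fun j => by
        rw [← zpow_natCast, ← zpow_natCast, ← zpow_sub₀ (h0 j)]
        congr 1
        omega
      simp only [e, Finset.prod_div_distrib]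
      rw [div_eq_one_iff_eq (Finset.prod_ne_zero_iff.2 fun j _ => pow_ne_zero _ (h0 j))]
    rw [e]
    refine IsClosed.inter ?_ (isClosed_biInter fun v _ => isClosed_eq (by fun_prop) (by fun_prop))
    simp only [Set.ofPred_forall]
    exact isClosed_iInter fun j => isClosed_eq (by fun_prop) (by fun_prop)
  · refine (Metric.isBounded_closedBall (x := (0 : P.EigIdx → ℂ)) (r := 1)).subset fun μ hμ => ?_
    rw [mem_closedBall_zero_iff, pi_norm_le_iff_of_nonneg zero_le_one]
    exact fun j => (hμ.1 j).le

theorem continuous_Φ (E : P.EqClass) (x : Fin n → ℝ) : Continuous (P.Φ E x) := by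
  unfold Φ
  fun_prop

variable {P}

/-- All eigenvalues in a class share one modulus, which factors out; their phases are absorbed into
the torus point. -/
theorem IsDominant.Φ_iterate {p₀ : P.Idx} {x : Fin n → ℝ} (hx : P.IsDominant (P.cls p₀) x)
    (μ : P.EigIdx → ℂ) (m : ℕ) :
    P.Φ (P.cls p₀) (P.f^[m] x) μ =
      ‖(p₀.2 : ℂ)‖ ^ m * P.Φ (P.cls p₀) x (fun j => P.γ j ^ m * μ j) := by
  rw [Φ, Φ, ← Complex.re_ofReal_mul, Finset.mul_sum]
  congr 1
  refine Finset.sum_congr rfl fun p hp => ?_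
  have hp' : P.cls p = P.cls p₀ := by simpa using hp
  rw [hx.h_iterate hp'.ge, ← ((P.cls_eq_cls_iff).1 hp').1]
  conv_lhs => rw [← P.norm_mul_γ p.2]
  push_cast
  ring

/-- If some coefficient in the dominant class of `x` is non-zero, then at every point of the torus
the function `Φ` of that class is non-zero for some point of the orbit of `x`. -/
theorem IsDominant.exists_Φ_iterate_ne_zero {p₀ : P.Idx} {x : Fin n → ℝ}
    (hx : P.IsDominant (P.cls p₀) x) (h₀ : P.h p₀ x ≠ 0) {μ : P.EigIdx → ℂ} (hμ : μ ∈ P.torus) :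
    ∃ m, P.Φ (P.cls p₀) (P.f^[m] x) μ ≠ 0 := by
  classical
  by_contra! hall
  refine h₀ ?_
  have hz : P.h p₀ x * μ p₀.2 = 0 := by
    refine eq_zero_of_forall_sum_mul_pow_eq_zero
      (Finset.univ.filter fun p : P.Idx => P.cls p = P.cls p₀) (fun p => P.h p x * μ p.2)
      (fun p => (p.2 : ℂ)) ?_ (fun m => ?_) p₀ (by simp)
    -- Within a class the first index is constant, so the eigenvalue determines the index.
    · intro p hp q hq hpq
      have hp' : P.cls p = P.cls p₀ := by simpa using hp
      have hq' : P.cls q = P.cls p₀ := by simpa using hq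
      exact Prod.ext ((P.cls_eq_cls_iff).1 (hp'.trans hq'.symm)).2 (Subtype.ext hpq)
    -- `Φ` is only a real part; because the sum is real on the torus, the full complex sum vanishes.
    · have h1 := P.Φ_eq (P.cls p₀) (P.f^[m] x) hμ
      rw [hall m, Complex.ofReal_zero] at h1
      rw [h1]
      refine Finset.sum_congr (by ext; simp) fun p hp => ?_
      have hp' : P.cls p = P.cls p₀ := by simpa using hp
      rw [hx.h_iterate hp'.ge]
      ring
  have hne : μ p₀.2 ≠ 0 := fun h => by simpa [h] using hμ.1 p₀.2
  exact (mul_eq_zero.1 hz).resolve_right hne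

/-! ### Asymptotics of the guard -/

theorem isLittleO_choose_choose {i k : ℕ} (h : i < k) :
    (fun m : ℕ => (m.choose i : ℝ)) =o[atTop] fun m : ℕ => (m.choose k : ℝ) :=
  ((isTheta_choose i).1.trans_isLittleO
    ((isLittleO_pow_pow_atTop_of_lt h).comp_tendsto tendsto_natCast_atTop_atTop)).trans_isBigO
    (isTheta_choose k).2

theorem one_isBigO_choose (k : ℕ) :
    (fun _ : ℕ => (1 : ℝ)) =O[atTop] fun m : ℕ => (m.choose k : ℝ) := by
  refine IsBigO.of_bound 1 ((eventually_ge_atTop k).mono fun m hm => ?_)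
  have : 1 ≤ m.choose k := Nat.choose_pos hm
  simpa using this

/-- The exponential gap beats the polynomial factor `m ^ i`, and `m.choose k` is at least one for `m
≥ k`. -/
theorem isLittleO_choose_mul_pow {i k : ℕ} {r s : ℝ} (hr : 0 ≤ r) (hrs : r < s) :
    (fun m : ℕ => (m.choose i : ℝ) * r ^ m) =o[atTop] fun m : ℕ => (m.choose k : ℝ) * s ^ m := by
  have h1 : (fun m : ℕ => (m.choose i : ℝ) * r ^ m) =O[atTop] fun m : ℕ => (m : ℝ) ^ i * r ^ m :=
    (isTheta_choose i).1.mul (isBigO_refl _ _)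
  have h2 := isLittleO_pow_const_mul_const_pow_const_pow_of_norm_lt i
    (show ‖r‖ < s by rwa [Real.norm_of_nonneg hr])
  have h3 : (fun m : ℕ => s ^ m) =O[atTop] fun m : ℕ => (m.choose k : ℝ) * s ^ m := by
    simpa using (one_isBigO_choose k).mul (isBigO_refl (fun m : ℕ => s ^ m) atTop)
  exact (h1.trans_isLittleO h2).trans_isBigO h3

theorem isLittleO_choose_mul_pow_of_lt {p q : P.Idx} (hpq : p < q) :
    (fun m : ℕ => (m.choose p.1 : ℝ) * ‖(p.2 : ℂ)‖ ^ m) =o[atTop]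
      fun m : ℕ => (m.choose q.1 : ℝ) * ‖(q.2 : ℂ)‖ ^ m := by
  rcases (P.idx_lt_iff).1 hpq with h | ⟨h, h'⟩
  · exact isLittleO_choose_mul_pow (norm_nonneg _) h
  · rw [h]
    exact (isLittleO_choose_choose (Fin.lt_def.1 h')).mul_isBigO (isBigO_refl _ _)

/-- The guard values are asymptotically governed by a dominant class. -/
theorem IsDominant.guard_sub_isLittleO {p₀ : P.Idx} {x : Fin n → ℝ}
    (hx : P.IsDominant (P.cls p₀) x) :
    (fun m : ℕ => P.g (P.f^[m] x) - (m.choose p₀.1 : ℝ) * ‖(p₀.2 : ℂ)‖ ^ m *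
        P.Φ (P.cls p₀) x (fun j => P.γ j ^ m)) =o[atTop]
      fun m : ℕ => (m.choose p₀.1 : ℝ) * ‖(p₀.2 : ℂ)‖ ^ m := by
  classical
  -- Outside the class, indices below it contribute terms of smaller order and those above it
  -- contribute zero.
  have key : (fun m : ℕ => ∑ p : P.Idx with ¬ P.cls p = P.cls p₀,
      (m.choose p.1 : ℂ) * (p.2 : ℂ) ^ m * P.h p x) =o[atTop]
      fun m : ℕ => (m.choose p₀.1 : ℝ) * ‖(p₀.2 : ℂ)‖ ^ m := by
    refine IsLittleO.fun_sum fun p hp => ?_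
    have hp' : P.cls p ≠ P.cls p₀ := by simpa using hp
    rcases P.cls_trichotomy p p₀ with h | h | h
    · have h1 := (isLittleO_choose_mul_pow_of_lt h).const_mul_left ‖P.h p x‖
      refine (IsBigO.of_norm_le fun m => ?_).trans_isLittleO h1
      simp [mul_comm]
    · exact absurd h hp'
    · simp only [hx p (P.cls_lt_cls_iff.2 h), mul_zero]
      exact isLittleO_zero _ _
  refine IsLittleO.congr' (f₁ := fun m : ℕ => (∑ p : P.Idx with ¬ P.cls p = P.cls p₀,
      (m.choose p.1 : ℂ) * (p.2 : ℂ) ^ m * P.h p x).re) ?_ ?_ EventuallyEq.rfl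
  · exact (IsBigO.of_norm_le fun m => Complex.abs_re_le_norm _).trans_isLittleO key.norm_left
  · refine (eventually_ge_atTop n).mono fun m hm => ?_
    have h1 := P.guard_iterate x m hm
    rw [← Finset.sum_filter_add_sum_filter_not Finset.univ (fun p => P.cls p = P.cls p₀)] at h1
    have h2 : ∑ p : P.Idx with P.cls p = P.cls p₀, (m.choose p.1 : ℂ) * (p.2 : ℂ) ^ m * P.h p x =
        (((m.choose p₀.1 : ℝ) * ‖(p₀.2 : ℂ)‖ ^ m *
          P.Φ (P.cls p₀) x (fun j => P.γ j ^ m) : ℝ) : ℂ) := by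
      rw [Complex.ofReal_mul, P.Φ_eq _ _ (P.γ_pow_mem_torus m), Finset.mul_sum]
      refine Finset.sum_congr (by ext; simp) fun p hp => ?_
      have hp' : P.cls p = P.cls p₀ := by simpa using hp
      obtain ⟨e1, e2⟩ := (P.cls_eq_cls_iff).1 hp'
      rw [← e1, ← e2]
      conv_lhs => rw [← P.norm_mul_γ p.2]
      push_cast
      ring
    rw [h2, ← sub_eq_iff_eq_add', ← Complex.ofReal_sub] at h1
    simp only [← h1, Complex.ofReal_re]

/-- The minimum of `Φ` over the compact torus is positive, and it serves as the constant in the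
little-o bound: the error is eventually at most the main term. -/
theorem IsDominant.eventuallyNonTerminating {p₀ : P.Idx} {x : Fin n → ℝ}
    (hx : P.IsDominant (P.cls p₀) x) (hpos : ∀ μ ∈ P.torus, 0 < P.Φ (P.cls p₀) x μ) :
    P.EventuallyNonTerminating x := by
  obtain ⟨ν, hν, hmin⟩ := P.isCompact_torus.exists_isMinOn ⟨1, P.one_mem_torus⟩
    (P.continuous_Φ (P.cls p₀) x).continuousOn
  have hev := (hx.guard_sub_isLittleO.bound (hpos ν hν))
  obtain ⟨N, hN⟩ := eventually_atTop.1 hev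
  refine ⟨N, fun m hm => ?_⟩
  have h1 := hN m hm
  have hw : 0 ≤ (m.choose p₀.1 : ℝ) * ‖(p₀.2 : ℂ)‖ ^ m := by positivity
  rw [Real.norm_of_nonneg hw, Real.norm_eq_abs] at h1
  have h2 : P.Φ (P.cls p₀) x ν ≤ P.Φ (P.cls p₀) x (fun j => P.γ j ^ m) :=
    hmin (P.γ_pow_mem_torus m)
  have h3 := mul_le_mul_of_nonneg_left h2 hw
  have h4 := (abs_le.1 h1).1
  linarith

/-! ### Convexity and the case of vanishing coefficients -/

variable (P)

theorem convex_setOf_isDominant_Φ_nonneg (E : P.EqClass) :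
    Convex ℝ {y | P.IsDominant E y ∧ ∀ μ ∈ P.torus, 0 ≤ P.Φ E y μ} := by
  rintro x ⟨hx, hx'⟩ y ⟨hy, hy'⟩ s t hs ht hst
  refine ⟨hx.combo hy hst, fun μ hμ => ?_⟩
  rw [P.Φ_combo E x y μ hst]
  exact add_nonneg (mul_nonneg hs (hx' μ hμ)) (mul_nonneg ht (hy' μ hμ))

theorem convex_setOf_h_eq_zero : Convex ℝ {y | ∀ p, P.h p y = 0} := by
  intro x hx y hy s t _ _ hst p
  rw [P.h_combo p x y hst, hx p, hy p, mul_zero, mul_zero, add_zero]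

theorem h_f_eq_zero {x : Fin n → ℝ} (hx : ∀ p, P.h p x = 0) (p : P.Idx) :
    P.h p (P.f x) = 0 := by
  rw [P.h_f_of_forall_lt fun q _ => hx q, hx p, mul_zero]

theorem eventuallyNonTerminating_of_h_eq_zero {x : Fin n → ℝ} (hx : ∀ p, P.h p x = 0) :
    P.EventuallyNonTerminating x := by
  refine ⟨n, fun m hm => ?_⟩
  have h1 := P.guard_iterate x m hm
  simp only [hx, mul_zero, Finset.sum_const_zero, Complex.ofReal_eq_zero] at h1
  exact h1.ge

end AffineLoop

theorem mainTheorem4 (n : ℕ) (P : AffineLoop n) (hP : P.NonDegenerate)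
    (z : Fin n → ℝ) (hz : z ∈ P.PN) :
    ∀ x ∈ intrinsicInterior ℝ (convexHull ℝ (Set.range fun m : ℕ => P.f^[m] z)),
      P.EventuallyNonTerminating x := by
  intro x hx
  by_cases hall : ∀ p, P.h p z = 0
  · refine P.eventuallyNonTerminating_of_h_eq_zero
      (convexHull_min ?_ P.convex_setOf_h_eq_zero (intrinsicInterior_subset hx))
    rintro _ ⟨m, rfl⟩
    change ∀ p, P.h p (P.f^[m] z) = 0
    induction m with
    | zero => exact hall
    | succ m ih => rw [Function.iterate_succ_apply']; exact P.h_f_eq_zero ih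
  push Not at hall
  -- Maximality makes every coefficient strictly above `p₀` vanish, so the class of `p₀` is
  -- dominant.
  obtain ⟨p₀, hp₀⟩ := (Set.toFinite {p : P.Idx | P.h p z ≠ 0}).exists_maximal hall
  have h₀ : P.h p₀ z ≠ 0 := hp₀.1
  have hdom : P.IsDominant (P.cls p₀) z := fun q hq => by
    by_contra hne
    exact hp₀.not_gt hne (P.cls_lt_cls_iff.1 hq)
  have hnn := (P.iInf_Φ_nonneg_iff _ _).1 (hz _ hdom)
  have hsub : convexHull ℝ (Set.range fun m : ℕ => P.f^[m] z) ⊆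
      {y | P.IsDominant (P.cls p₀) y ∧ ∀ μ ∈ P.torus, 0 ≤ P.Φ (P.cls p₀) y μ} := by
    refine convexHull_min ?_ (P.convex_setOf_isDominant_Φ_nonneg _)
    rintro _ ⟨m, rfl⟩
    refine ⟨hdom.iterate m, fun μ hμ => ?_⟩
    change 0 ≤ P.Φ (P.cls p₀) (P.f^[m] z) μ
    rw [hdom.Φ_iterate]
    exact mul_nonneg (by positivity) (hnn _ (P.γ_pow_mul_mem_torus hμ m))
  refine (hsub (intrinsicInterior_subset hx)).1.eventuallyNonTerminating fun μ hμ => ?_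
  -- The orbit point may depend on `μ`: pointwise positivity suffices, as compactness supplies
  -- uniformity.
  obtain ⟨m, hm⟩ := hdom.exists_Φ_iterate_ne_zero h₀ hμ
  have hmem : P.f^[m] z ∈ convexHull ℝ (Set.range fun m : ℕ => P.f^[m] z) :=
    subset_convexHull ℝ _ ⟨m, rfl⟩
  have hpos := ((hsub hmem).2 μ hμ).lt_of_ne' hm
  obtain ⟨w, hw, t, ht0, ht1, rfl⟩ := AffineLoop.exists_combo_of_mem_intrinsicInterior hx hmem
  rw [P.Φ_combo _ _ _ _ (by ring)]
  exact add_pos_of_pos_of_nonneg (mul_pos ht0 hpos)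
    (mul_nonneg (by linarith) ((hsub hw).2 μ hμ))
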